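/- Let $(s(n))_{n\ge 0}$ be Stern's diatomic sequence, defined by $s(0)=0$, $s(1)=1$ and, for $n\ge 0$, $s(2n)=s(n)$ and $s(2n+1)=s(n)+s(n+1)$. Let $(b_n)_{n\ge 0}$ be the Baum–Sweet sequence, defined by $b_0=1$ and, for $n\ge 0$, $b_{4n}=b_{2n+1}=b_n$ and $b_{4n+2}=0$. Let $$S(z)=\sum_{n\ge 0}s(n)z^n,\qquad B(z)=\sum_{n\ge 0}b_nz^n$$ be their generating functions, regarded as elements of the field $\mathbb{C}((z))$ of formal Laurent series, which contains $\mathbb{C}(z)$ by Laurent expansion at $0$. Then $S(z)$ and $B(z)$ are algebraically independent over $\mathbb{C}(z)$; equivalently, $$\operatorname{tr.deg}_{\mathbb{C}(z)}\mathbb{C}(z)\bigl(S(z),B(z)\bigr)=2.$$ -/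

import Mathlib

open scoped LaurentSeries

/-- Stern's diatomic sequence: `s 0 = 0`, `s 1 = 1`, `s (2n) = s n`, `s (2n+1) = s n + s (n+1)`. -/
def sternSeq (n : ℕ) : ℕ :=
  if n = 0 then 0
  else if n = 1 then 1
  else if n % 2 = 0 then sternSeq (n / 2)
  else sternSeq (n / 2) + sternSeq (n / 2 + 1)
termination_by n
decreasing_by all_goals omega

/-- The Baum-Sweet sequence: `b 0 = 1`, `b (4n) = b (2n+1) = b n`, `b (4n+2) = 0`. -/
def baumSweetSeq (n : ℕ) : ℕ :=
  if n = 0 then 1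
  else if n % 2 = 1 then baumSweetSeq (n / 2)
  else if n % 4 = 0 then baumSweetSeq (n / 4)
  else 0
termination_by n
decreasing_by all_goals omega

theorem sternSeq_zero : sternSeq 0 = 0 := by
  rw [sternSeq]; simp

theorem sternSeq_one : sternSeq 1 = 1 := by
  rw [sternSeq]; simp

theorem sternSeq_two_mul (n : ℕ) : sternSeq (2 * n) = sternSeq n := by
  rcases Nat.eq_zero_or_pos n with rfl | hn
  · rfl
  · conv_lhs => rw [sternSeq]
    rw [if_neg (by omega), if_neg (by omega), if_pos (by omega)]
    congr 1
    omega

theorem sternSeq_two_mul_add_one (n : ℕ) :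
    sternSeq (2 * n + 1) = sternSeq n + sternSeq (n + 1) := by
  rcases Nat.eq_zero_or_pos n with rfl | hn
  · simp [sternSeq_zero]
  · conv_lhs => rw [sternSeq]
    rw [if_neg (by omega), if_neg (by omega), if_neg (by omega),
      show (2 * n + 1) / 2 = n by omega]

theorem baumSweetSeq_zero : baumSweetSeq 0 = 1 := by
  rw [baumSweetSeq]; simp

theorem baumSweetSeq_four_mul (n : ℕ) : baumSweetSeq (4 * n) = baumSweetSeq n := by
  rcases Nat.eq_zero_or_pos n with rfl | hn
  · rfl
  · conv_lhs => rw [baumSweetSeq]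
    rw [if_neg (by omega), if_neg (by omega), if_pos (by omega),
      show 4 * n / 4 = n by omega]

theorem baumSweetSeq_two_mul_add_one (n : ℕ) :
    baumSweetSeq (2 * n + 1) = baumSweetSeq n := by
  conv_lhs => rw [baumSweetSeq]
  rw [if_neg (by omega), if_pos (by omega), show (2 * n + 1) / 2 = n by omega]

theorem baumSweetSeq_four_mul_add_two (n : ℕ) : baumSweetSeq (4 * n + 2) = 0 := by
  rw [baumSweetSeq, if_neg (by omega), if_neg (by omega), if_neg (by omega)]

/-- Stern's generating function `S(z) = ∑ s(n) zⁿ`, as a power series over `ℂ`. -/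
noncomputable def sternSeries : PowerSeries ℂ :=
  PowerSeries.mk fun n => (sternSeq n : ℂ)

/-- The Baum-Sweet generating function `B(z) = ∑ b(n) zⁿ`, as a power series over `ℂ`. -/
noncomputable def baumSweetSeries : PowerSeries ℂ :=
  PowerSeries.mk fun n => (baumSweetSeq n : ℂ)

/-- The field of formal Laurent series `ℂ((z))` as an extension of the field `ℂ(z)` of rational
functions: a rational function acts through its Laurent expansion at `0`. This is Mathlib's scoped
instance, activated for this one field only. -/
noncomputable instance ratFuncAlgebraLaurentSeries : Algebra (RatFunc ℂ) (LaurentSeries ℂ) :=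
  RatFunc.liftAlgebra ℂ (LaurentSeries ℂ)

/-!
Let `τ` be the operator `f(z) ↦ f(z ^ 2)` on Laurent series. The recurrence of Stern's sequence
makes `S` an eigenvector, `τ S = a S` with `a = z / (1 + z + z ^ 2)`, and that of the Baum–Sweet
sequence makes `u = τ B / B` a solution of the Riccati equation `u * τ u = 1 - z * u`.

Apply `τ` to a shortest relation among the monomials `S ^ i * B ^ j` with coefficients in `ℂ(z)[u]`
and eliminate one term. Either the relation gets shorter or the ratio of two coefficients is an
eigenvector; clearing common factors, this yields a binary form over `ℂ(z)` which the substitution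
`U ↦ 1 / U - z` reproduces up to a scalar. The minimal polynomial of `u`, if `u` were algebraic,
would be such a form too.

Made primitive over `ℂ[z]`, such a form `Q` of degree `N` satisfies
`Q(z ^ 2, U) = c * (U + z) ^ N * Q(z, 1 / (U + z))`. In the component of top total degree in `z` and
`U`, the left side has a definite parity in `U`, so the power of `U + z` dividing the right side
comes with the same power of `U - z`; this is too much for the degree unless `N = 0`.

A form of degree `0` is a rational function `f` with `τ f * a ^ i = f * a ^ j`. After cancelling the
powers of `z - 1`, evaluation at the fixed point `z = 1` gives `2 ^ m * 3 ^ j = 2 ^ n * 3 ^ i`, so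
`i = j`.
-/

section AlgebraicIndependence

open Polynomial

section RiccatiTransform

variable {R : Type*} [CommRing R] {σ : R →+* R} {z : R}

/-- The twisted action of the Riccati substitution `U ↦ 1 / U - z` on binary forms of degree `N`.
A form is encoded by its dehomogenisation `P`, of degree at most `N`, and is sent to
`U ^ N * P^σ (1 / U - z)`, where `P^σ` has the coefficients of `P` moved by `σ`. -/
noncomputable def riccatiTransform (σ : R →+* R) (z : R) (N : ℕ) (P : R[X]) : R[X] :=
  reflect N (taylor (-z) (P.map σ))

lemma natDegree_taylor_map_le (P : R[X]) : (taylor z (P.map σ)).natDegree ≤ P.natDegree :=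
  (natDegree_taylor _ _).trans_le natDegree_map_le

lemma riccatiTransform_add (N : ℕ) (P Q : R[X]) :
    riccatiTransform σ z N (P + Q) = riccatiTransform σ z N P + riccatiTransform σ z N Q := by
  simp only [riccatiTransform, Polynomial.map_add, map_add, reflect_add]

lemma riccatiTransform_mul {P Q : R[X]} {M N : ℕ} (hP : P.natDegree ≤ M) (hQ : Q.natDegree ≤ N) :
    riccatiTransform σ z (M + N) (P * Q) = riccatiTransform σ z M P * riccatiTransform σ z N Q := by
  simp only [riccatiTransform, Polynomial.map_mul, taylor_mul]
  exact reflect_mul _ _ ((natDegree_taylor_map_le P).trans hP)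
    ((natDegree_taylor_map_le Q).trans hQ)

lemma riccatiTransform_one (N : ℕ) : riccatiTransform σ z N (1 : R[X]) = X ^ N := by
  simp [riccatiTransform]

lemma riccatiTransform_zero_C (r : R) : riccatiTransform σ z 0 (C r) = C (σ r) := by
  simp [riccatiTransform]

lemma natDegree_riccatiTransform_le {P : R[X]} {N : ℕ} (hP : P.natDegree ≤ N) :
    (riccatiTransform σ z N P).natDegree ≤ N :=
  natDegree_reflect_le.trans (max_le le_rfl ((natDegree_taylor_map_le P).trans hP))

lemma aeval_riccatiTransform {L : Type*} [Field L] [Algebra R L] {τ : L →+* L}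
    (hτ : ∀ r, τ (algebraMap R L r) = algebraMap R L (σ r)) {u : L}
    (hu : u * τ u = 1 - algebraMap R L z * u) {P : R[X]} {N : ℕ} (hP : P.natDegree ≤ N) :
    aeval u (riccatiTransform σ z N P) = u ^ N * τ (aeval u P) := by
  have hu0 : u ≠ 0 := by rintro rfl; simp at hu
  let _ : Invertible u⁻¹ := invertibleOfNonzero (inv_ne_zero hu0)
  have hreflect := eval₂_reflect_mul_pow (algebraMap R L) u⁻¹ N (taylor (-z) (P.map σ))
    ((natDegree_taylor_map_le P).trans hP)
  have hsubst : eval₂ (algebraMap R L) u⁻¹ (X + C (-z)) = τ u := by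
    rw [eval₂_add, eval₂_X, eval₂_C, map_neg]
    field_simp
    linear_combination -hu
  have hcomm : (algebraMap R L).comp σ = τ.comp (algebraMap R L) := RingHom.ext fun r => (hτ r).symm
  rw [invOf_eq_inv, inv_inv, taylor_apply, eval₂_comp, eval₂_map, hsubst, hcomm, ← hom_eval₂,
    ← taylor_apply] at hreflect
  rw [aeval_def, aeval_def, ← hreflect, riccatiTransform, mul_comm, mul_assoc, ← mul_pow,
    inv_mul_cancel₀ hu0, one_pow, mul_one]

end RiccatiTransform

section SemiInvariantForms

variable {K : Type*} [Field K] {σ : K →+* K} {z : K}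

lemma riccatiTransform_eq_zero_iff {P : K[X]} {N : ℕ} : riccatiTransform σ z N P = 0 ↔ P = 0 := by
  rw [riccatiTransform, reflect_eq_zero_iff, taylor_eq_zero, Polynomial.map_eq_zero]

lemma coeff_zero_riccatiTransform_natDegree (P : K[X]) :
    (riccatiTransform σ z P.natDegree P).coeff 0 = σ P.leadingCoeff := by
  rw [riccatiTransform, coeff_reflect, revAt_zero, ← natDegree_map σ,
    ← natDegree_taylor (P.map σ) (-z), coeff_natDegree, leadingCoeff_taylor, leadingCoeff_map]

lemma exists_riccatiTransform_add_eq_X_pow {P Q : K[X]} (hPQ : IsCoprime P Q) {m n : ℕ}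
    (hm : P.natDegree ≤ m) (hn : Q.natDegree ≤ n) :
    ∃ A B : K[X], ∃ M : ℕ, A * riccatiTransform σ z m P + B * riccatiTransform σ z n Q = X ^ M := by
  obtain ⟨a, b, hab⟩ := hPQ
  refine ⟨riccatiTransform σ z (a.natDegree + b.natDegree + n) a,
    riccatiTransform σ z (a.natDegree + b.natDegree + m) b,
    a.natDegree + b.natDegree + n + m, ?_⟩
  rw [← riccatiTransform_mul (by omega) hm, ← riccatiTransform_mul (by omega) hn,
    add_right_comm _ m n, ← riccatiTransform_add, hab, riccatiTransform_one]

/-- The degree condition says that the two forms have no common zero at infinity. -/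
lemma isCoprime_riccatiTransform {P Q : K[X]} (hP : P ≠ 0) (hQ : Q ≠ 0) (hPQ : IsCoprime P Q)
    {m n : ℕ} (hm : P.natDegree ≤ m) (hn : Q.natDegree ≤ n)
    (hmn : m = P.natDegree ∨ n = Q.natDegree) :
    IsCoprime (riccatiTransform σ z m P) (riccatiTransform σ z n Q) := by
  refine isCoprime_of_prime_dvd (fun h => hP (riccatiTransform_eq_zero_iff.mp h.1))
    fun T hT hTP hTQ => ?_
  obtain ⟨A, B, M, hX⟩ := exists_riccatiTransform_add_eq_X_pow (σ := σ) (z := z) hPQ hm hn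
  have hTX : T ∣ X :=
    hT.dvd_of_dvd_pow (hX ▸ dvd_add (hTP.mul_left A) (hTQ.mul_left B) : T ∣ X ^ M)
  have hXT : X ∣ T := (hT.associated_of_dvd prime_X hTX).symm.dvd
  rcases hmn with rfl | rfl
  · have := X_dvd_iff.mp (hXT.trans hTP)
    rw [coeff_zero_riccatiTransform_natDegree, map_eq_zero, leadingCoeff_eq_zero] at this
    exact hP this
  · have := X_dvd_iff.mp (hXT.trans hTQ)
    rw [coeff_zero_riccatiTransform_natDegree, map_eq_zero, leadingCoeff_eq_zero] at this
    exact hQ this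

/-- A nonzero binary form of degree `N`, encoded by its dehomogenisation `P`, which
`riccatiTransform σ z N` multiplies by a constant. -/
structure IsSemiInvariantForm (σ : K →+* K) (z : K) (N : ℕ) (P : K[X]) : Prop where
  ne_zero : P ≠ 0
  natDegree_le : P.natDegree ≤ N
  exists_eq_C_mul : ∃ γ : K, riccatiTransform σ z N P = C γ * P

lemma isSemiInvariantForm_of_isCoprime {P Q : K[X]} (hP : P ≠ 0) (hQ : Q ≠ 0)
    (hPQ : IsCoprime P Q) {m n : ℕ} (hm : P.natDegree ≤ m) (hn : Q.natDegree ≤ n)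
    (hmn : m = P.natDegree ∨ n = Q.natDegree) {c : K} (hc : c ≠ 0)
    (h : riccatiTransform σ z m P * Q = C c * (P * riccatiTransform σ z n Q)) :
    IsSemiInvariantForm σ z m P := by
  have hdvd : P ∣ riccatiTransform σ z m P :=
    hPQ.dvd_of_dvd_mul_right (h ▸ (dvd_mul_right P _).mul_left _)
  have hdvd' : riccatiTransform σ z m P ∣ P := by
    have hcop := isCoprime_riccatiTransform (σ := σ) (z := z) hP hQ hPQ hm hn hmn
    refine hcop.dvd_of_dvd_mul_right ?_
    rw [← (isUnit_C.mpr hc.isUnit).dvd_mul_left, ← h]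
    exact dvd_mul_right _ _
  obtain ⟨ε, hε⟩ := associated_of_dvd_dvd hdvd hdvd'
  obtain ⟨γ, -, hγ⟩ := Polynomial.isUnit_iff.mp ε.isUnit
  exact ⟨hP, hm, γ, by rw [hγ, mul_comm, hε]⟩

lemma isSemiInvariantForm_minpoly {L : Type*} [Field L] [Algebra K L] {τ : L →+* L}
    (hτ : ∀ k, τ (algebraMap K L k) = algebraMap K L (σ k)) {u : L}
    (hu : u * τ u = 1 - algebraMap K L z * u) (hint : IsIntegral K u) :
    IsSemiInvariantForm σ z (minpoly K u).natDegree (minpoly K u) := by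
  have hroot : aeval u (riccatiTransform σ z (minpoly K u).natDegree (minpoly K u)) = 0 := by
    rw [aeval_riccatiTransform hτ hu le_rfl, minpoly.aeval, map_zero, mul_zero]
  have hdeg := natDegree_riccatiTransform_le (σ := σ) (z := z) (le_refl (minpoly K u).natDegree)
  exact ⟨minpoly.ne_zero hint, le_rfl, _,
    eq_leadingCoeff_mul_of_monic_of_dvd_of_natDegree_le (minpoly.monic hint)
      (minpoly.dvd K u hroot) hdeg⟩

lemma transcendental_of_forall_isSemiInvariantForm {L : Type*} [Field L] [Algebra K L]
    {τ : L →+* L} (hτ : ∀ k, τ (algebraMap K L k) = algebraMap K L (σ k)) {u : L}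
    (hu : u * τ u = 1 - algebraMap K L z * u)
    (hform : ∀ N P, IsSemiInvariantForm σ z N P → N = 0) : Transcendental K u := fun halg =>
  (minpoly.natDegree_pos halg.isIntegral).ne'
    (hform _ _ (isSemiInvariantForm_minpoly hτ hu halg.isIntegral))

/-- The last disjunction says that the cofactors `p` and `q`, seen as forms of degrees `m'` and
`n'`, have no common zero at infinity. -/
lemma exists_eq_mul_isCoprime_of_natDegree_le {P Q : K[X]} (hP : P ≠ 0) (hQ : Q ≠ 0) {m n : ℕ}
    (hm : P.natDegree ≤ m) (hn : Q.natDegree ≤ n) :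
    ∃ (G p q : K[X]) (g m' n' : ℕ), P = G * p ∧ Q = G * q ∧ IsCoprime p q ∧
      m = g + m' ∧ n = g + n' ∧ G.natDegree ≤ g ∧ p.natDegree ≤ m' ∧ q.natDegree ≤ n' ∧
      (m' = p.natDegree ∨ n' = q.natDegree) := by
  classical
  obtain ⟨p, q, hp, hq, hcop⟩ := extract_gcd P Q
  rw [gcd_isUnit_iff] at hcop
  set G := gcd P Q
  have hdegP := hm
  rw [hp, natDegree_mul (left_ne_zero_of_mul (hp ▸ hP)) (right_ne_zero_of_mul (hp ▸ hP))] at hdegP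
  have hdegQ := hn
  rw [hq, natDegree_mul (left_ne_zero_of_mul (hq ▸ hQ)) (right_ne_zero_of_mul (hq ▸ hQ))] at hdegQ
  let g := min (m - p.natDegree) (n - q.natDegree)
  exact ⟨G, p, q, g, m - g, n - g, hp, hq, hcop, by omega, by omega, by omega, by omega, by omega,
    by omega⟩

lemma eq_C_mul_of_riccatiTransform_mul_eq
    (hform : ∀ N P, IsSemiInvariantForm σ z N P → N = 0) {P Q : K[X]} (hP : P ≠ 0) (hQ : Q ≠ 0)
    {m n : ℕ} (hm : P.natDegree ≤ m) (hn : Q.natDegree ≤ n) {c : K} (hc : c ≠ 0)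
    (h : riccatiTransform σ z m P * Q = C c * (P * riccatiTransform σ z n Q)) :
    m = n ∧ ∃ f : K, f ≠ 0 ∧ P = C f * Q ∧ σ f = c * f := by
  obtain ⟨G, p, q, g, m', n', rfl, rfl, hcop, rfl, rfl, hG, hp, hq, hmn⟩ :=
    exists_eq_mul_isCoprime_of_natDegree_le hP hQ hm hn
  obtain ⟨hG0, hp0⟩ := mul_ne_zero_iff.mp hP
  have hq0 : q ≠ 0 := right_ne_zero_of_mul hQ
  have hpq : riccatiTransform σ z m' p * q = C c * (p * riccatiTransform σ z n' q) := by
    have hTG : riccatiTransform σ z g G ≠ 0 := riccatiTransform_eq_zero_iff.not.mpr hG0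
    rw [riccatiTransform_mul hG hp, riccatiTransform_mul hG hq] at h
    refine mul_left_cancel₀ (mul_ne_zero hTG hG0) ?_
    linear_combination h
  have hqp : riccatiTransform σ z n' q * p = C c⁻¹ * (q * riccatiTransform σ z m' p) := by
    have hcc : C c⁻¹ * C c = (1 : K[X]) := by rw [← C_mul, inv_mul_cancel₀ hc, C_1]
    linear_combination (-riccatiTransform σ z n' q * p) * hcc - C c⁻¹ * hpq
  obtain rfl : m' = 0 :=
    hform _ _ (isSemiInvariantForm_of_isCoprime hp0 hq0 hcop hp hq hmn hc hpq)
  obtain rfl : n' = 0 := hform _ _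
    (isSemiInvariantForm_of_isCoprime hq0 hp0 hcop.symm hq hp hmn.symm (inv_ne_zero hc) hqp)
  obtain ⟨α, rfl⟩ := natDegree_eq_zero.mp (Nat.le_zero.mp hp)
  obtain ⟨β, rfl⟩ := natDegree_eq_zero.mp (Nat.le_zero.mp hq)
  have hα : α ≠ 0 := C_ne_zero.mp hp0
  have hβ : β ≠ 0 := C_ne_zero.mp hq0
  have hσβ : σ β ≠ 0 := (map_ne_zero σ).mpr hβ
  simp only [riccatiTransform_zero_C, ← C_mul] at hpq
  refine ⟨rfl, α / β, div_ne_zero hα hβ, ?_, ?_⟩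
  · rw [mul_left_comm, ← C_mul, div_mul_cancel₀ α hβ]
  · rw [map_div₀]
    field_simp
    linear_combination C_injective hpq

end SemiInvariantForms

section LinearRelations

open Finsupp

/-- A shortest nontrivial relation `l` would be shortened by eliminating a coefficient between `l`
and the relation `l'` that accompanies it. -/
lemma linearIndependent_of_forall_exists_relation {ι R M : Type*} [CommRing R] [AddCommGroup M]
    [Module R M] {v : ι → M} (hv : ∀ i (r : R), r • v i = 0 → r = 0)
    (h : ∀ l : ι →₀ R, linearCombination R v l = 0 → ∃ l' : ι →₀ R,
      linearCombination R v l' = 0 ∧ l'.support ⊆ l.support ∧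
        ∀ i ∈ l.support, ∀ j ∈ l.support, l' i * l j = l i * l' j → i = j) :
    LinearIndependent R v := by
  rw [linearIndependent_iff]
  intro l hl
  induction hn : l.support.card using Nat.strong_induction_on generalizing l with
  | _ n ih =>
  obtain ⟨l', hl', hsupp, hcross⟩ := h l hl
  by_contra hl0
  obtain ⟨i, hi⟩ := Finsupp.support_nonempty_iff.mpr hl0
  have hlt : (l' i • l - l i • l').support ⊂ l.support := by
    refine (Finset.ssubset_iff_of_subset fun j hj => ?_).mpr
      ⟨i, hi, by simp [mul_comm (l' i)]⟩
    contrapose hj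
    have hj' : j ∉ l'.support := fun hmem => hj (hsupp hmem)
    simp [notMem_support_iff.mp hj, notMem_support_iff.mp hj']
  have helim : l' i • l - l i • l' = 0 :=
    ih _ (hn ▸ Finset.card_lt_card hlt) _ (by simp [hl, hl']) rfl
  have hsingle : l = single i (l i) := by
    refine eq_single_iff.mpr ⟨fun j hj => ?_, rfl⟩
    have := DFunLike.congr_fun helim j
    simpa using (hcross i hi j hj (sub_eq_zero.mp this)).symm
  rw [hsingle, linearCombination_single] at hl
  exact mem_support_iff.mp hi (hv i _ hl)

lemma algebraicIndependent_iff_linearIndependent_monomials {ι R A : Type*} [CommRing R]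
    [CommRing A] [Algebra R A] {x : ι → A} :
    AlgebraicIndependent R x ↔
      LinearIndependent R fun m : ι →₀ ℕ => m.prod fun i k => x i ^ k := by
  have hcomb : (MvPolynomial.aeval x).toLinearMap ∘ₗ
      (MvPolynomial.basisMonomials ι R).repr.symm.toLinearMap =
        linearCombination R fun m : ι →₀ ℕ => m.prod fun i k => x i ^ k := by
    ext m
    simp [MvPolynomial.aeval_monomial]
  rw [LinearIndependent, ← hcomb, LinearMap.coe_comp, LinearEquiv.coe_coe, EquivLike.injective_comp]
  exact algebraicIndependent_iff_injective_aeval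

end LinearRelations

section Criterion

variable {K L : Type*} [Field K] [Field L] [Algebra K L] {σ : K →+* K} {τ : L →+* L} {z a : K}
  {S B u : L}

lemma exists_forall_natDegree_le {ι R : Type*} [Semiring R] (l : ι →₀ R[X]) :
    ∃ N, ∀ i, (l i).natDegree ≤ N := by
  refine ⟨l.support.sup fun i => (l i).natDegree, fun i => ?_⟩
  by_cases hi : i ∈ l.support
  · exact Finset.le_sup (f := fun i => (l i).natDegree) hi
  · simp [Finsupp.notMem_support_iff.mp hi]

lemma exists_transformed_relation (hτ : ∀ k, τ (algebraMap K L k) = algebraMap K L (σ k))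
    (hS : τ S = algebraMap K L a * S) (hB : τ B = u * B)
    (hu : u * τ u = 1 - algebraMap K L z * u) (l : (Fin 2 →₀ ℕ) →₀ K[X]) {N : ℕ}
    (hN : ∀ m, (l m).natDegree ≤ N) :
    ∃ l' : (Fin 2 →₀ ℕ) →₀ K[X],
      (∀ m, l' m = C (a ^ m 0) * riccatiTransform σ z (N + m 1) (l m)) ∧
      l'.sum (fun m P => aeval u P * (S ^ m 0 * B ^ m 1)) =
        u ^ N * τ (l.sum fun m P => aeval u P * (S ^ m 0 * B ^ m 1)) := by
  have hsupp : ∀ m, C (a ^ m 0) * riccatiTransform σ z (N + m 1) (l m) ≠ 0 → m ∈ l.support :=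
    fun m hm => Finsupp.mem_support_iff.mpr fun h0 => hm (by
      rw [h0, riccatiTransform_eq_zero_iff.mpr rfl, mul_zero])
  refine ⟨Finsupp.onFinset l.support _ hsupp, fun m => rfl, ?_⟩
  rw [Finsupp.onFinset_sum _ fun m => by simp, Finsupp.sum, map_sum, Finset.mul_sum]
  refine Finset.sum_congr rfl fun m _ => ?_
  simp only [map_mul, map_pow, aeval_C, hS, hB,
    aeval_riccatiTransform hτ hu ((hN m).trans (Nat.le_add_right N (m 1)))]
  ring

lemma exponents_eq_of_riccatiTransform_mul_eq (ha : a ≠ 0)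
    (hform : ∀ N P, IsSemiInvariantForm σ z N P → N = 0)
    (hmul : ∀ f : K, f ≠ 0 → ∀ i j : ℕ, σ f * a ^ i = f * a ^ j → i = j) {P Q : K[X]}
    (hP : P ≠ 0) (hQ : Q ≠ 0) {N i j i' j' : ℕ} (hPN : P.natDegree ≤ N) (hQN : Q.natDegree ≤ N)
    (h : C (a ^ i) * riccatiTransform σ z (N + j) P * Q =
      P * (C (a ^ i') * riccatiTransform σ z (N + j') Q)) : i = i' ∧ j = j' := by
  have hai : a ^ i ≠ 0 := pow_ne_zero _ ha
  have hCai : C (a ^ i)⁻¹ * C (a ^ i) = (1 : K[X]) := by rw [← C_mul, inv_mul_cancel₀ hai, C_1]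
  have hquot : riccatiTransform σ z (N + j) P * Q =
      C (a ^ i' / a ^ i) * (P * riccatiTransform σ z (N + j') Q) := by
    rw [div_eq_mul_inv, C_mul]
    linear_combination C (a ^ i)⁻¹ * h - riccatiTransform σ z (N + j) P * Q * hCai
  obtain ⟨hjj', f, hf, -, hσf⟩ := eq_C_mul_of_riccatiTransform_mul_eq hform hP hQ
    (hPN.trans (Nat.le_add_right N j)) (hQN.trans (Nat.le_add_right N j'))
    (div_ne_zero (pow_ne_zero _ ha) hai) hquot
  exact ⟨hmul f hf _ _ (by rw [hσf]; field_simp), Nat.add_left_cancel hjj'⟩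

theorem algebraicIndependent_of_forall_isSemiInvariantForm
    (hτ : ∀ k, τ (algebraMap K L k) = algebraMap K L (σ k)) (ha : a ≠ 0)
    (hform : ∀ N P, IsSemiInvariantForm σ z N P → N = 0)
    (hmul : ∀ f : K, f ≠ 0 → ∀ i j : ℕ, σ f * a ^ i = f * a ^ j → i = j)
    (hS0 : S ≠ 0) (hB0 : B ≠ 0) (hS : τ S = algebraMap K L a * S) (hB : τ B = u * B)
    (hu : u * τ u = 1 - algebraMap K L z * u) : AlgebraicIndependent K ![S, B] := by
  have hu_tr : Transcendental K u := transcendental_of_forall_isSemiInvariantForm hτ hu hform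
  let _ : Algebra K[X] L := (aeval u : K[X] →ₐ[K] L).toAlgebra
  have hsmul (P : K[X]) (x : L) : P • x = aeval u P * x := rfl
  have : IsScalarTower K K[X] L := .of_algebraMap_eq fun k => (aeval_C u k).symm
  suffices AlgebraicIndependent K[X] ![S, B] from this.restrictScalars C_injective
  rw [algebraicIndependent_iff_linearIndependent_monomials]
  have hmonomials : (fun m : Fin 2 →₀ ℕ => m.prod fun i k => ![S, B] i ^ k) =
      fun m => S ^ m 0 * B ^ m 1 := by
    ext m
    simp [Finsupp.prod_fintype, Fin.prod_univ_two]
  rw [hmonomials]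
  refine linearIndependent_of_forall_exists_relation (fun m P hP => ?_) fun l hl => ?_
  · have hne : S ^ m 0 * B ^ m 1 ≠ 0 := mul_ne_zero (pow_ne_zero _ hS0) (pow_ne_zero _ hB0)
    exact transcendental_iff.mp hu_tr P ((mul_eq_zero_iff_right hne).mp hP)
  · simp only [Finsupp.linearCombination_apply, hsmul] at hl ⊢
    obtain ⟨N, hN⟩ := exists_forall_natDegree_le l
    obtain ⟨l', hl', hrel⟩ := exists_transformed_relation hτ hS hB hu l hN
    refine ⟨l', by rw [hrel, hl, map_zero, mul_zero], fun m hm => ?_, fun i hi j hj h => ?_⟩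
    · rw [Finsupp.mem_support_iff, hl'] at hm
      exact Finsupp.mem_support_iff.mpr fun h0 => hm (by
        rw [h0, riccatiTransform_eq_zero_iff.mpr rfl, mul_zero])
    · rw [hl', hl'] at h
      obtain ⟨h0, h1⟩ := exponents_eq_of_riccatiTransform_mul_eq ha hform hmul
        (Finsupp.mem_support_iff.mp hi) (Finsupp.mem_support_iff.mp hj) (hN i) (hN j) h
      ext t
      fin_cases t
      exacts [h0, h1]

end Criterion

section TotalDegree

open Bivariate

variable {R : Type*} [CommRing R]

lemma coeff_coeff_swap (P : R[X][Y]) (m n : ℕ) :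
    ((swap P).coeff m).coeff n = (P.coeff n).coeff m := by
  induction P using Polynomial.induction_on' with
  | add P Q hP hQ => simp only [map_add, coeff_add, hP, hQ]
  | monomial i p =>
    induction p using Polynomial.induction_on' with
    | add p q hp hq => simp only [map_add, coeff_add, hp, hq]
    | monomial j r =>
      rw [swap_monomial_monomial]
      simp only [coeff_monomial, apply_ite (coeff · n), apply_ite (coeff · m), coeff_zero]
      split_ifs <;> rfl

/-- The ring homomorphism `P(z, U) ↦ P(t, t U)`, with values in the polynomials in `t` over
`R[U]`. The coefficient of `t ^ n` is the homogeneous component of `P` of total degree `n`,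
dehomogenised at `z = 1`. -/
noncomputable def gradedExpansion : R[X][Y] →+* R[X][X] :=
  (swap : R[X][Y] ≃ₐ[R] R[X][Y]).toRingEquiv.toRingHom.comp (compRingHom (C X * X))

lemma gradedExpansion_apply (P : R[X][Y]) : gradedExpansion P = swap (P.comp (C X * X)) := rfl

lemma coeff_coeff_gradedExpansion (P : R[X][Y]) (n k : ℕ) :
    ((gradedExpansion P).coeff n).coeff k = if k ≤ n then (P.coeff k).coeff (n - k) else 0 := by
  rw [gradedExpansion_apply, coeff_coeff_swap, comp_C_mul_X_coeff, coeff_mul_X_pow']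

lemma gradedExpansion_C (q : R[X]) : gradedExpansion (C q) = q.map C := by
  rw [gradedExpansion_apply, C_comp, swap_C]

lemma gradedExpansion_X : gradedExpansion (X : R[X][Y]) = C X * X := by
  rw [gradedExpansion_apply, X_comp, map_mul, swap_X, swap_Y, mul_comm]

lemma gradedExpansion_C_mul_X_add_C_X_pow (q : R[X]) (j : ℕ) :
    gradedExpansion (C q * (X + C X) ^ j) = (q * X ^ j).map C * C ((X + 1) ^ j) := by
  have hadd : (C X * X + X : R[X][X]) = X * C (X + 1) := by
    rw [C_add, C_1]
    ring
  simp only [map_mul, map_pow, map_add, gradedExpansion_C, gradedExpansion_X, Polynomial.map_mul,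
    Polynomial.map_pow, map_X, hadd, mul_pow, mul_assoc]

lemma reflect_eq_sum_range {S : Type*} [CommRing S] {Q : S[X]} {N : ℕ} (hN : Q.natDegree ≤ N) :
    reflect N Q = ∑ i ∈ Finset.range (N + 1), C (Q.coeff i) * X ^ (N - i) := by
  have hdeg : (reflect N Q).natDegree < N + 1 :=
    Nat.lt_succ_of_le (natDegree_reflect_le.trans (max_le le_rfl hN))
  rw [(reflect N Q).as_sum_range_C_mul_X_pow' hdeg, ← Finset.sum_range_reflect]
  refine Finset.sum_congr rfl fun i hi => ?_
  rw [Nat.add_sub_cancel, coeff_reflect, revAt_le (Nat.sub_le N i),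
    Nat.sub_sub_self (Finset.mem_range_succ_iff.mp hi)]

lemma coeff_gradedExpansion_taylor_reflect {Q : R[X][Y]} {N : ℕ} (hN : Q.natDegree ≤ N) (n : ℕ) :
    (gradedExpansion (taylor X (reflect N Q))).coeff n =
      ∑ k ∈ Finset.range (N + 1), C ((Q.coeff k * X ^ (N - k)).coeff n) * (X + 1) ^ (N - k) := by
  simp only [reflect_eq_sum_range hN, map_sum, taylor_mul, taylor_C, taylor_X_pow,
    gradedExpansion_C_mul_X_add_C_X_pow, finsetSum_coeff, coeff_mul_C, coeff_map]

lemma X_add_one_pow_dvd_coeff_gradedExpansion_taylor_reflect {Q : R[X][Y]} {N n M : ℕ}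
    (hN : Q.natDegree ≤ N)
    (hM : ∀ i ≤ N, (Q.coeff i * X ^ (N - i)).coeff n ≠ 0 → M ≤ N - i) :
    (X + 1) ^ M ∣ (gradedExpansion (taylor X (reflect N Q))).coeff n := by
  rw [coeff_gradedExpansion_taylor_reflect hN]
  refine Finset.dvd_sum fun i hi => ?_
  by_cases hne : (Q.coeff i * X ^ (N - i)).coeff n = 0
  · rw [hne, C_0, zero_mul]
    exact dvd_zero _
  · exact (pow_dvd_pow _ (hM i (Finset.mem_range_succ_iff.mp hi) hne)).mul_left _

end TotalDegree

section DegreeBound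

open Bivariate

variable {k : Type*} [Field k]

lemma comp_neg_X_eq_neg_one_pow_mul {R : Type*} [CommRing R] {p : R[X]} {n : ℕ}
    (hpar : ∀ i, p.coeff i ≠ 0 → Even (n + i)) : p.comp (-X) = (-1) ^ n * p := by
  ext i
  rw [show (-1 : R[X]) ^ n = C ((-1) ^ n) by simp, show (-X : R[X]) = C (-1) * X by simp,
    comp_C_mul_X_coeff, coeff_C_mul, mul_comm]
  by_cases hi : p.coeff i = 0
  · rw [hi, mul_zero, mul_zero]
  · rw [neg_one_pow_congr (Nat.even_add.mp (hpar i hi))]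

lemma two_mul_le_natDegree_of_X_add_one_pow_dvd (h2 : (2 : k) ≠ 0) {p : k[X]} (hp : p ≠ 0)
    {n m : ℕ} (hpar : ∀ i, p.coeff i ≠ 0 → Even (n + i)) (hdvd : (X + 1) ^ m ∣ p) :
    2 * m ≤ p.natDegree := by
  have hunit : ∀ j, IsUnit ((-1 : k[X]) ^ j) := fun j => isUnit_neg_one.pow j
  have hdvd' : (X - 1) ^ m ∣ p := by
    have h : ((X + 1) ^ m).comp (-X) ∣ p.comp (-X) := _root_.map_dvd (compRingHom (-X)) hdvd
    rwa [comp_neg_X_eq_neg_one_pow_mul hpar, (hunit n).dvd_mul_left,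
      show ((X + 1) ^ m).comp (-X) = (-1) ^ m * (X - 1 : k[X]) ^ m by
        rw [← mul_pow]; simp [neg_add_eq_sub], (hunit m).mul_left_dvd] at h
  have hcop : IsCoprime (X + 1 : k[X]) (X - 1) := by
    refine ⟨C 2⁻¹, -C 2⁻¹, ?_⟩
    have : C (2⁻¹ : k) * 2 = 1 := by rw [← C_ofNat, ← C_mul, inv_mul_cancel₀ h2, C_1]
    linear_combination this
  have hdeg := natDegree_le_of_dvd (hcop.pow.mul_dvd hdvd hdvd') hp
  rw [← C_1, ((monic_X_add_C _).pow m).natDegree_mul ((monic_X_sub_C _).pow m), natDegree_pow,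
    natDegree_pow, natDegree_X_add_C, natDegree_X_sub_C] at hdeg
  omega

lemma coeff_gradedExpansion_map_expand (Q : k[X][Y]) (a i : ℕ) :
    ((gradedExpansion (Q.map (expand k 2 : k[X] →+* k[X]))).coeff (2 * a + i)).coeff i =
      (Q.coeff i).coeff a := by
  rw [coeff_coeff_gradedExpansion, if_pos (Nat.le_add_left i _), Nat.add_sub_cancel, coeff_map]
  exact coeff_expand_mul' two_pos _ _

lemma exists_of_coeff_gradedExpansion_map_expand_ne_zero {Q : k[X][Y]} {n i : ℕ}
    (h : ((gradedExpansion (Q.map (expand k 2 : k[X] →+* k[X]))).coeff n).coeff i ≠ 0) :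
    Q.coeff i ≠ 0 ∧ ∃ a, n = 2 * a + i := by
  rw [coeff_coeff_gradedExpansion, coeff_map, RingHom.coe_coe, coeff_expand two_pos] at h
  simp only [ne_eq, ite_eq_right_iff, Classical.not_imp] at h
  obtain ⟨hin, ⟨a, ha⟩, hne⟩ := h
  exact ⟨fun h0 => hne (by rw [h0, coeff_zero]), a, by omega⟩

lemma gradedExpansion_map_expand_ne_zero {Q : k[X][Y]} (hQ : Q ≠ 0) :
    gradedExpansion (Q.map (expand k 2 : k[X] →+* k[X])) ≠ 0 := by
  intro h
  refine hQ (Polynomial.ext fun i => Polynomial.ext fun a => ?_)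
  rw [← coeff_gradedExpansion_map_expand, h]
  simp only [coeff_zero]

/-- Compare the homogeneous components of top total degree `n`. On the left the exponents of `U`
have the parity of `n`; on the right there is a high power of `U + 1`, hence of `U ^ 2 - 1`. -/
lemma eq_zero_of_map_expand_eq_C_mul_taylor_reflect (h2 : (2 : k) ≠ 0) {Q : k[X][Y]} (hQ : Q ≠ 0)
    {N : ℕ} (hN : Q.natDegree ≤ N) {c : k}
    (h : Q.map (expand k 2 : k[X] →+* k[X]) = C (C c) * taylor X (reflect N Q)) : N = 0 := by
  set f := gradedExpansion (Q.map (expand k 2 : k[X] →+* k[X])) with hf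
  set n := f.natDegree
  have hlead : f.coeff n ≠ 0 := leadingCoeff_ne_zero.mpr (gradedExpansion_map_expand_ne_zero hQ)
  have htop {a i : ℕ} (hai : (Q.coeff i).coeff a ≠ 0) : 2 * a + i ≤ n :=
    le_natDegree_of_ne_zero fun h0 => hai (by
      rw [← coeff_gradedExpansion_map_expand Q a i, ← hf, h0, coeff_zero])
  have hparity (i : ℕ) (hi : (f.coeff n).coeff i ≠ 0) : Even (n + i) := by
    obtain ⟨-, a, ha⟩ := exists_of_coeff_gradedExpansion_map_expand_ne_zero hi
    exact ⟨a + i, by omega⟩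
  have hdeg : (f.coeff n).natDegree ≤ n ∧ (f.coeff n).natDegree ≤ N := by
    obtain ⟨hQi, a, ha⟩ := exists_of_coeff_gradedExpansion_map_expand_ne_zero
      (i := (f.coeff n).natDegree) (leadingCoeff_ne_zero.mpr hlead)
    exact ⟨by omega, (le_natDegree_of_ne_zero hQi).trans hN⟩
  have hbound (M : ℕ) (hM : ∀ i, n + 3 * i ≤ 2 * N → M ≤ N - i) :
      2 * M ≤ (f.coeff n).natDegree := by
    refine two_mul_le_natDegree_of_X_add_one_pow_dvd h2 hlead hparity ?_
    rw [hf, h, map_mul, gradedExpansion_C, map_C, coeff_C_mul]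
    refine (X_add_one_pow_dvd_coeff_gradedExpansion_taylor_reflect hN fun i hi hne => ?_).mul_left _
    rw [coeff_mul_X_pow', ite_ne_right_iff] at hne
    have := htop hne.2
    exact hM i (by omega)
  rcases le_or_gt n (2 * N) with hn | hn
  · have := hbound (N - (2 * N - n) / 3) fun i hi => by omega
    omega
  · have := hbound (N + 1) fun i hi => by omega
    omega

end DegreeBound

section PrimitivePolynomials

variable {A : Type*} [CommRing A] {Q : A[X]}

lemma isPrimitive_taylor (hQ : Q.IsPrimitive) (r : A) : (taylor r Q).IsPrimitive := fun s hs =>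
  hQ s (by
    obtain ⟨T, hT⟩ := hs
    refine ⟨taylor (-r) T, ?_⟩
    rw [← taylor_C (-r) s, ← taylor_mul, ← hT, taylor_taylor, neg_add_cancel, taylor_zero])

lemma isPrimitive_reflect (hQ : Q.IsPrimitive) (N : ℕ) : (reflect N Q).IsPrimitive := fun r hr =>
  hQ r (by
    obtain ⟨T, hT⟩ := hr
    exact ⟨reflect N T, by rw [← reflect_C_mul, ← hT, reflect_reflect]⟩)

lemma isPrimitive_map [IsPrincipalIdealRing A] {B : Type*} [CommRing B] (f : A →+* B)
    (hQ : Q.IsPrimitive) : (Q.map f).IsPrimitive := by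
  refine isPrimitive_of_contentIdeal_eq_top ?_
  rw [contentIdeal_map_eq_map_contentIdeal,
    ((IsPrincipalIdealRing.principal _).isPrimitive_iff_contentIdeal_eq_top).mp hQ, Ideal.map_top]

section FractionField

variable [IsDomain A] [NormalizedGCDMonoid A] (K : Type*) [Field K] [Algebra A K]
  [IsFractionRing A K]

lemma exists_eq_C_mul_map_isPrimitive {P : K[X]} (hP : P ≠ 0) :
    ∃ (d : K) (Q : A[X]), d ≠ 0 ∧ Q.IsPrimitive ∧ P = C d * Q.map (algebraMap A K) := by
  obtain ⟨b, hb, h⟩ := IsLocalization.integerNormalization_spec (nonZeroDivisors A) P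
  set Q := IsLocalization.integerNormalization (nonZeroDivisors A) P
  have hb0 : algebraMap A K b ≠ 0 := IsFractionRing.to_map_ne_zero_of_mem_nonZeroDivisors hb
  have hPQ : P = C ((algebraMap A K b)⁻¹ * algebraMap A K Q.content) *
      Q.primPart.map (algebraMap A K) := by
    rw [C_mul, mul_assoc, ← map_C (algebraMap A K), ← Polynomial.map_mul,
      ← Q.eq_C_content_mul_primPart, h, Algebra.smul_def, Polynomial.algebraMap_apply,
      ← mul_assoc, ← C_mul, inv_mul_cancel₀ hb0, C_1, one_mul]
  exact ⟨_, _, C_ne_zero.mp (left_ne_zero_of_mul (hPQ ▸ hP)), Q.isPrimitive_primPart, hPQ⟩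

lemma associated_of_map_eq_C_mul_map {P : A[X]} (hP : P.IsPrimitive) (hQ : Q.IsPrimitive) {e : K}
    (h : P.map (algebraMap A K) = C e * Q.map (algebraMap A K)) : Associated P Q := by
  have he : e ≠ 0 := by
    rintro rfl
    rw [C_0, zero_mul, Polynomial.map_eq_zero_iff (IsFractionRing.injective A K)] at h
    exact hP.ne_zero h
  have hassoc : Associated (P.map (algebraMap A K)) (Q.map (algebraMap A K)) := by
    rw [h]
    exact associated_unit_mul_left _ _ (isUnit_C.mpr he.isUnit)
  exact associated_of_dvd_dvd
    (hP.dvd_of_fraction_map_dvd_fraction_map hassoc.dvd)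
    (hQ.dvd_of_fraction_map_dvd_fraction_map hassoc.symm.dvd)

end FractionField

end PrimitivePolynomials

section NoSemiInvariantForms

lemma map_eq_C_mul_taylor_reflect {K : Type*} [Field K] {σ : K →+* K} {z γ d : K} (hd : d ≠ 0)
    {N : ℕ} {P : K[X]} (h : riccatiTransform σ z N (C d * P) = C γ * (C d * P)) :
    P.map σ = C (γ * d / σ d) * taylor z (reflect N P) := by
  have hσd : σ d ≠ 0 := (map_ne_zero σ).mpr hd
  have hinv : C (σ d) * P.map σ = C (γ * d) * taylor z (reflect N P) := by
    have := congrArg (fun T => taylor z (reflect N T)) h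
    simpa only [riccatiTransform, reflect_reflect, taylor_taylor, add_neg_cancel, taylor_zero,
      ← mul_assoc, ← C_mul, reflect_C_mul, taylor_mul, taylor_C, Polynomial.map_mul, map_C]
      using this
  refine mul_left_cancel₀ (C_ne_zero.mpr hσd) ?_
  rw [hinv, ← mul_assoc, ← C_mul, mul_div_cancel₀ _ hσd]

lemma eq_zero_of_isSemiInvariantForm_X {k : Type*} [Field k] (h2 : (2 : k) ≠ 0)
    {K : Type*} [Field K] [Algebra k[X] K] [IsFractionRing k[X] K] {σ : K →+* K}
    (hσ : ∀ p : k[X], σ (algebraMap k[X] K p) = algebraMap k[X] K (expand k 2 p)) {N : ℕ}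
    {P : K[X]} (hP : IsSemiInvariantForm σ (algebraMap k[X] K X) N P) : N = 0 := by
  classical
  obtain ⟨hP0, hN, γ, hγ⟩ := hP
  obtain ⟨d, Q, hd, hQ, rfl⟩ := exists_eq_C_mul_map_isPrimitive (A := k[X]) K hP0
  have hinj : Function.Injective (algebraMap k[X] K) := IsFractionRing.injective _ _
  rw [natDegree_C_mul hd, natDegree_map_eq_of_injective hinj] at hN
  have hcomp : σ.comp (algebraMap k[X] K) = (algebraMap k[X] K).comp (expand k 2 : k[X] →+* k[X]) :=
    RingHom.ext hσ
  have hassoc : Associated (taylor X (reflect N Q)) (Q.map (expand k 2 : k[X] →+* k[X])) := by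
    refine (associated_of_map_eq_C_mul_map K (isPrimitive_map _ hQ)
      (isPrimitive_taylor (isPrimitive_reflect hQ N) X) (e := γ * d / σ d) ?_).symm
    rw [Polynomial.map_map, ← hcomp, ← Polynomial.map_map, map_taylor, ← reflect_map]
    exact map_eq_C_mul_taylor_reflect hd hγ
  obtain ⟨ε, hε⟩ := hassoc
  obtain ⟨r, hr, hrε⟩ := Polynomial.isUnit_iff.mp ε.isUnit
  obtain ⟨c, -, rfl⟩ := Polynomial.isUnit_iff.mp hr
  exact eq_zero_of_map_expand_eq_C_mul_taylor_reflect h2 hQ.ne_zero hN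
    (by rw [hrε, mul_comm, hε])

end NoSemiInvariantForms

section ExponentComparison

lemma eq_of_two_pow_mul_three_pow_eq {m n i j : ℕ} (h : 2 ^ m * 3 ^ j = 2 ^ n * 3 ^ i) :
    i = j := by
  have hle {l l' s t : ℕ} (h : 2 ^ l * 3 ^ t = 2 ^ l' * 3 ^ s) : s ≤ t :=
    (Nat.pow_dvd_pow_iff_le_right (by norm_num)).mp
      ((Nat.Coprime.pow s l (by norm_num)).dvd_of_dvd_mul_left (h ▸ dvd_mul_left (3 ^ s) (2 ^ l')))
  exact le_antisymm (hle h) (hle h.symm)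

variable {k : Type*} [Field k] [CharZero k]

/-- Cancel the powers of `X - 1` and evaluate at the fixed point `1` of `z ↦ z ^ 2`. -/
lemma exponents_eq_of_expand_mul_eq {p q : k[X]} (hp : p ≠ 0) (hq : q ≠ 0) {i j : ℕ}
    (h : expand k 2 p * q * (X ^ i * (1 + X + X ^ 2) ^ j) =
      p * expand k 2 q * (X ^ j * (1 + X + X ^ 2) ^ i)) : i = j := by
  obtain ⟨p₁, hp₁, hp1⟩ := exists_eq_pow_rootMultiplicity_mul_and_not_dvd p hp 1
  obtain ⟨q₁, hq₁, hq1⟩ := exists_eq_pow_rootMultiplicity_mul_and_not_dvd q hq 1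
  set m := p.rootMultiplicity 1
  set n := q.rootMultiplicity 1
  have hexpand : expand k 2 (X - C 1) = (X - C 1) * (X + 1) := by
    rw [map_sub, expand_X, expand_C, C_1]
    ring
  have hcancel : (X + 1) ^ m * expand k 2 p₁ * q₁ * (X ^ i * (1 + X + X ^ 2) ^ j) =
      p₁ * ((X + 1) ^ n * expand k 2 q₁) * (X ^ j * (1 + X + X ^ 2) ^ i) := by
    rw [hp₁, hq₁, map_mul, map_mul, map_pow, map_pow, hexpand, mul_pow, mul_pow] at h
    refine mul_left_cancel₀ (pow_ne_zero (m + n) (X_sub_C_ne_zero (1 : k))) ?_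
    linear_combination h
  have heval := congrArg (eval 1) hcancel
  simp only [eval_mul, eval_pow, eval_add, eval_X, eval_one, expand_eval, one_pow, one_mul,
    one_add_one_eq_two] at heval
  rw [dvd_iff_isRoot, IsRoot.def] at hp1 hq1
  refine eq_of_two_pow_mul_three_pow_eq (m := m) (n := n) ?_
  have : (2 ^ m * 3 ^ j : k) = 2 ^ n * 3 ^ i := by
    refine mul_left_cancel₀ (mul_ne_zero hp1 hq1) ?_
    rw [show (2 + 1 : k) = 3 by norm_num] at heval
    linear_combination heval
  exact_mod_cast this

lemma exponents_eq_of_mul_pow_eq_mul_pow {K : Type*} [Field K] [Algebra k[X] K]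
    [IsFractionRing k[X] K] {σ : K →+* K}
    (hσ : ∀ p : k[X], σ (algebraMap k[X] K p) = algebraMap k[X] K (expand k 2 p)) {f : K}
    (hf : f ≠ 0) {i j : ℕ}
    (h : σ f * (algebraMap k[X] K X / algebraMap k[X] K (1 + X + X ^ 2)) ^ i =
      f * (algebraMap k[X] K X / algebraMap k[X] K (1 + X + X ^ 2)) ^ j) : i = j := by
  have hinj : Function.Injective (algebraMap k[X] K) := IsFractionRing.injective _ _
  have hne {r : k[X]} (hr : r ≠ 0) : algebraMap k[X] K r ≠ 0 := (map_ne_zero_iff _ hinj).mpr hr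
  obtain ⟨p, q, hq, rfl⟩ := IsFractionRing.div_surjective k[X] f
  have hq0 : q ≠ 0 := nonZeroDivisors.ne_zero hq
  have hp0 : p ≠ 0 := by
    rintro rfl
    simp at hf
  have hquad : (1 + X + X ^ 2 : k[X]) ≠ 0 := fun h0 => by simpa using congrArg (eval 0) h0
  refine exponents_eq_of_expand_mul_eq hp0 hq0 (hinj ?_)
  have hq1 := hne hq0
  have hq2 := hne ((expand_ne_zero two_pos).mpr hq0)
  have hq3 := hne hquad
  rw [map_div₀, hσ, hσ, div_pow, div_pow] at h
  field_simp at h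
  simp only [map_mul, map_pow]
  linear_combination h

end ExponentComparison

section MahlerOperators

lemma powerSeriesExpand_injective {R : Type*} [CommRing R] {p : ℕ} (hp : p ≠ 0) :
    Function.Injective (PowerSeries.expand (R := R) p hp) := by
  intro f g h
  ext n
  rw [← PowerSeries.coeff_expand_mul p hp f n, h, PowerSeries.coeff_expand_mul]

lemma powerSeriesExpand_coe {R : Type*} [CommRing R] {p : ℕ} (hp : p ≠ 0) (f : R[X]) :
    PowerSeries.expand p hp (f : PowerSeries R) = (expand R p f : R[X]) := by
  ext n
  rw [PowerSeries.coeff_expand, coeff_coe, coeff_coe, coeff_expand hp.bot_lt]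

variable {k : Type*} [Field k] {p : ℕ} (hp : p ≠ 0)

/-- The Mahler operator `f(z) ↦ f(z ^ p)` on rational functions. -/
noncomputable def ratFuncExpand : RatFunc k →+* RatFunc k :=
  IsFractionRing.map (j := (expand k p : k[X] →+* k[X])) (expand_injective hp.bot_lt)

/-- The Mahler operator `f(z) ↦ f(z ^ p)` on formal Laurent series. -/
noncomputable def laurentSeriesExpand : LaurentSeries k →+* LaurentSeries k :=
  IsFractionRing.map (j := (PowerSeries.expand (R := k) p hp).toRingHom)
    (powerSeriesExpand_injective hp)

lemma ratFuncExpand_algebraMap (f : k[X]) :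
    ratFuncExpand hp (algebraMap k[X] (RatFunc k) f) =
      algebraMap k[X] (RatFunc k) (expand k p f) := by
  simp only [ratFuncExpand, IsFractionRing.map, IsLocalization.map_eq, RingHom.coe_coe]

lemma laurentSeriesExpand_coe (f : PowerSeries k) :
    laurentSeriesExpand hp (f : LaurentSeries k) = (PowerSeries.expand p hp f : PowerSeries k) := by
  rw [laurentSeriesExpand, IsFractionRing.map, ← LaurentSeries.coe_algebraMap,
    IsLocalization.map_eq]
  rfl

lemma algebraMap_ratFunc_laurentSeries_algebraMap (f : ℂ[X]) :
    algebraMap (RatFunc ℂ) (LaurentSeries ℂ) (algebraMap ℂ[X] (RatFunc ℂ) f) =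
      ((f : PowerSeries ℂ) : LaurentSeries ℂ) :=
  (RatFunc.coe_coe f).symm

lemma laurentSeriesExpand_algebraMap (f : RatFunc ℂ) :
    laurentSeriesExpand hp (algebraMap (RatFunc ℂ) (LaurentSeries ℂ) f) =
      algebraMap (RatFunc ℂ) (LaurentSeries ℂ) (ratFuncExpand hp f) := by
  have hcomm : (laurentSeriesExpand hp).comp (algebraMap (RatFunc ℂ) (LaurentSeries ℂ)) =
      (algebraMap (RatFunc ℂ) (LaurentSeries ℂ)).comp (ratFuncExpand hp) := by
    refine IsLocalization.ringHom_ext (nonZeroDivisors ℂ[X]) (RingHom.ext fun f => ?_)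
    simp only [RingHom.comp_apply, algebraMap_ratFunc_laurentSeries_algebraMap,
      laurentSeriesExpand_coe, ratFuncExpand_algebraMap, powerSeriesExpand_coe]
  exact RingHom.congr_fun hcomm f

end MahlerOperators

section FunctionalEquations

lemma coeff_sternSeries (n : ℕ) : PowerSeries.coeff n sternSeries = (sternSeq n : ℂ) :=
  PowerSeries.coeff_mk n _

lemma coeff_baumSweetSeries (n : ℕ) : PowerSeries.coeff n baumSweetSeries = (baumSweetSeq n : ℂ) :=
  PowerSeries.coeff_mk n _

lemma sternSeries_ne_zero : sternSeries ≠ 0 := fun h => by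
  simpa [h, sternSeq_one] using coeff_sternSeries 1

lemma baumSweetSeries_ne_zero : baumSweetSeries ≠ 0 := fun h => by
  simpa [h, baumSweetSeq_zero] using coeff_baumSweetSeries 0

lemma X_mul_sternSeries : PowerSeries.X * sternSeries =
    (1 + PowerSeries.X + PowerSeries.X ^ 2) * PowerSeries.expand 2 two_ne_zero sternSeries := by
  ext n
  simp only [add_mul, one_mul, map_add, PowerSeries.coeff_X_pow_mul', PowerSeries.coeff_expand]
  rcases n with _ | _ | n
  · have hzero : PowerSeries.constantCoeff sternSeries = 0 := by
      rw [← PowerSeries.coeff_zero_eq_constantCoeff_apply, coeff_sternSeries, sternSeq_zero,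
        Nat.cast_zero]
    simp [hzero]
  · simp [coeff_sternSeries, sternSeq_zero, PowerSeries.coeff_succ_X_mul, PowerSeries.coeff_expand]
  · simp only [PowerSeries.coeff_succ_X_mul, PowerSeries.coeff_expand, coeff_sternSeries]
    rcases Nat.even_or_odd' n with ⟨m, rfl | rfl⟩
    · rw [if_pos (by omega), if_neg (by omega), if_pos (by omega), if_pos (by omega),
        show (2 * m + 1 + 1) / 2 = m + 1 by omega, show (2 * m + 1 + 1 - 2) / 2 = m by omega,
        sternSeq_two_mul_add_one]
      push_cast
      ring
    · rw [if_neg (by omega), if_pos (by omega), if_pos (by omega), if_neg (by omega),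
        show (2 * m + 1 + 1) / 2 = m + 1 by omega, show 2 * m + 1 + 1 = 2 * (m + 1) by ring,
        sternSeq_two_mul]
      ring

lemma baumSweetSeries_eq : baumSweetSeries =
    PowerSeries.X * PowerSeries.expand 2 two_ne_zero baumSweetSeries +
      PowerSeries.expand 2 two_ne_zero (PowerSeries.expand 2 two_ne_zero baumSweetSeries) := by
  ext n
  rcases n with _ | n
  · simp [PowerSeries.constantCoeff_expand]
  simp only [map_add, PowerSeries.coeff_succ_X_mul, PowerSeries.coeff_expand,
    coeff_baumSweetSeries]
  rcases Nat.even_or_odd' n with ⟨m, rfl | rfl⟩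
  · rw [if_pos (by omega), if_neg (by omega), Nat.mul_div_cancel_left m two_pos,
      baumSweetSeq_two_mul_add_one, add_zero]
  rw [if_neg (by omega), if_pos (by omega), zero_add]
  rcases Nat.even_or_odd' m with ⟨l, rfl | rfl⟩
  · rw [if_neg (by omega), show 2 * (2 * l) + 1 + 1 = 4 * l + 2 by ring,
      baumSweetSeq_four_mul_add_two, Nat.cast_zero]
  · rw [if_pos (by omega), show 2 * (2 * l + 1) + 1 + 1 = 4 * (l + 1) by ring,
      baumSweetSeq_four_mul, show 4 * (l + 1) / 2 / 2 = l + 1 by omega]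

lemma coe_sternSeries_ne_zero : (sternSeries : LaurentSeries ℂ) ≠ 0 :=
  (map_ne_zero_iff _ HahnSeries.ofPowerSeries_injective).mpr sternSeries_ne_zero

lemma coe_baumSweetSeries_ne_zero : (baumSweetSeries : LaurentSeries ℂ) ≠ 0 :=
  (map_ne_zero_iff _ HahnSeries.ofPowerSeries_injective).mpr baumSweetSeries_ne_zero

lemma algebraMap_one_add_X_add_X_sq_ne_zero :
    algebraMap ℂ[X] (RatFunc ℂ) (1 + X + X ^ 2) ≠ 0 :=
  (map_ne_zero_iff _ (IsFractionRing.injective ℂ[X] (RatFunc ℂ))).mpr fun h => by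
    simpa using congrArg (eval 0) h

lemma laurentSeriesExpand_sternSeries :
    laurentSeriesExpand two_ne_zero (sternSeries : LaurentSeries ℂ) =
      algebraMap (RatFunc ℂ) (LaurentSeries ℂ) (algebraMap ℂ[X] (RatFunc ℂ) X /
        algebraMap ℂ[X] (RatFunc ℂ) (1 + X + X ^ 2)) * (sternSeries : LaurentSeries ℂ) := by
  have hquad := (map_ne_zero (algebraMap (RatFunc ℂ) (LaurentSeries ℂ))).mpr
    algebraMap_one_add_X_add_X_sq_ne_zero
  rw [map_div₀, div_mul_eq_mul_div, eq_div_iff hquad, mul_comm,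
    algebraMap_ratFunc_laurentSeries_algebraMap, algebraMap_ratFunc_laurentSeries_algebraMap,
    laurentSeriesExpand_coe, ← map_mul, ← map_mul]
  simp only [coe_add, coe_one, coe_X, coe_pow, X_mul_sternSeries]

lemma baumSweetSeries_riccati {u : LaurentSeries ℂ}
    (hu : laurentSeriesExpand two_ne_zero (baumSweetSeries : LaurentSeries ℂ) =
      u * (baumSweetSeries : LaurentSeries ℂ)) :
    u * laurentSeriesExpand two_ne_zero u =
      1 - algebraMap (RatFunc ℂ) (LaurentSeries ℂ) (algebraMap ℂ[X] (RatFunc ℂ) X) * u := by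
  have hrec := congrArg (HahnSeries.ofPowerSeries ℤ ℂ) baumSweetSeries_eq
  simp only [map_add, map_mul, ← laurentSeriesExpand_coe, hu] at hrec
  rw [algebraMap_ratFunc_laurentSeries_algebraMap, coe_X]
  refine mul_right_cancel₀ coe_baumSweetSeries_ne_zero ?_
  linear_combination -hrec

end FunctionalEquations

section TranscendenceDegree

universe u v

lemma lift_trdeg_adjoin_range_of_algebraicIndependent {ι : Type u} {F : Type*} {E : Type v}
    [Field F] [Field E] [Algebra F E] {x : ι → E} (hx : AlgebraicIndependent F x) :
    Cardinal.lift.{u} (Algebra.trdeg F (IntermediateField.adjoin F (Set.range x))) =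
      Cardinal.lift.{v} (Cardinal.mk ι) := by
  have : Algebra.IsAlgebraic (MvPolynomial ι F) (FractionRing (MvPolynomial ι F)) :=
    IsLocalization.isAlgebraic _ (nonZeroDivisors (MvPolynomial ι F))
  have hX : IsTranscendenceBasis F
      (algebraMap (MvPolynomial ι F) (FractionRing (MvPolynomial ι F)) ∘ MvPolynomial.X) :=
    (IsTranscendenceBasis.mvPolynomial ι F).algebraMap_comp
  exact (hx.aevalEquivField.isTranscendenceBasis_iff.mpr hX).lift_cardinalMk_eq_trdeg.symm

end TranscendenceDegree

lemma algebraicIndependent_sternSeries_baumSweetSeries :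
    AlgebraicIndependent (RatFunc ℂ)
      ![(sternSeries : LaurentSeries ℂ), (baumSweetSeries : LaurentSeries ℂ)] :=
  have hu := (div_mul_cancel₀ (laurentSeriesExpand two_ne_zero (baumSweetSeries : LaurentSeries ℂ))
    coe_baumSweetSeries_ne_zero).symm
  algebraicIndependent_of_forall_isSemiInvariantForm (laurentSeriesExpand_algebraMap two_ne_zero)
    (div_ne_zero ((map_ne_zero_iff _ (IsFractionRing.injective ℂ[X] _)).mpr X_ne_zero)
      algebraMap_one_add_X_add_X_sq_ne_zero)
    (fun _ _ hP => eq_zero_of_isSemiInvariantForm_X two_ne_zero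
      (ratFuncExpand_algebraMap two_ne_zero) hP)
    (fun _ hf _ _ h => exponents_eq_of_mul_pow_eq_mul_pow
      (ratFuncExpand_algebraMap two_ne_zero) hf h)
    coe_sternSeries_ne_zero coe_baumSweetSeries_ne_zero laurentSeriesExpand_sternSeries
    hu (baumSweetSeries_riccati hu)

end AlgebraicIndependence

theorem mainTheorem10 :
    AlgebraicIndependent (RatFunc ℂ)
        ![(sternSeries : LaurentSeries ℂ), (baumSweetSeries : LaurentSeries ℂ)] ∧
      Algebra.trdeg (RatFunc ℂ)
        (IntermediateField.adjoin (RatFunc ℂ)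
          ({(sternSeries : LaurentSeries ℂ), (baumSweetSeries : LaurentSeries ℂ)} :
            Set (LaurentSeries ℂ))) = 2 := by
  refine ⟨algebraicIndependent_sternSeries_baumSweetSeries, ?_⟩
  have h := lift_trdeg_adjoin_range_of_algebraicIndependent
    algebraicIndependent_sternSeries_baumSweetSeries
  rw [Matrix.range_cons, Matrix.range_cons, Matrix.range_empty, Set.union_empty,
    Set.singleton_union] at h
  simpa using h
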